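/- Let $I\subseteq\mathbb R$ be an interval with more than one point and let $\gamma_1,\gamma_2:I\to\mathbb R$ be such that $d(x,y)=\gamma_1(x)\gamma_2(y)-\gamma_1(y)\gamma_2(x)\neq 0$ for all distinct $x,y\in I$ and $1\in\operatorname{span}\{\gamma_1,\gamma_2\}$. For distinct $x_0,\dots,x_n\in I$ the divided difference is defined recursively by $f_{\gamma_1,\gamma_2}[x_0]=f(x_0)$ and $$f_{\gamma_1,\gamma_2}[x_0,\dots,x_n]=\frac{f_{\gamma_1,\gamma_2}[x_0,\dots,x_{n-2},x_n]-f_{\gamma_1,\gamma_2}[x_0,\dots,x_{n-1}]}{d(x_{n-1},x_n)} ,$$ and the generalized derivative of $f$ at $a\in I$ is $D_{\gamma_1,\gamma_2}f(a)=\lim_{x\to a,\ x\in I\setminus\{a\}}\frac{f(x)-f(a)}{d(a,x)}$, provided the limit exists. An extended non-polynomial homogeneous blossom of order $k\in\mathbb Z$ of a function $H:I\to\mathbb R$ is a family of real-valued functions $h\big((x_1,w_1),\dots,(x_m,w_m)/(u_1,v_1),\dots,(u_n,v_n)\big)$, one for each pair $m,n\ge 0$ with $m-n=k$, where the $(x_i,w_i)$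 range over $\mathbb R^2$ and the $(u_j,v_j)$ over the curve $C=\{(\gamma_1(t),\gamma_2(t)):t\in I\}$, such that (i) $h$ is invariant under permutations of the $(x_i,w_i)$ and under permutations of the $(u_j,v_j)$; (ii) $h$ is linear in each $(x_i,w_i)$; (iii) $h\big((x_1,w_1),\dots,(x_m,w_m),(y,z)/(u_1,v_1),\dots,(u_n,v_n),(y,z)\big)=h\big((x_1,w_1),\dots,(x_m,w_m)/(u_1,v_1),\dots,(u_n,v_n)\big)$ for $(y,z)\in C$; (iv) if all the $(x_i,w_i)$ and all the $(u_j,v_j)$ equal $(\gamma_1(t),\gamma_2(t))$, $t\in I$, the value of $h$ is $H(t)$. Then every $H:I\to\mathbb R$ has an extended blossom of order $-1$. Moreover, for every $a\in I$ the derivatives $\delta_1=D_{\gamma_1,\gamma_2}\gamma_1(a)$, $\delta_2=D_{\gamma_1,\gamma_2}\gamma_2(a)$ and, for each $x\in I$, the derivative $D_{\gamma_1,\gamma_2}d(a,x)$ of $t\mapsto d(t,x)$ at $t=a$ exist. Finally, for every extended blossom $h$ of $H$ of order $-1$, every $m\ge 0$, $n=m+1$, every choice of distinct $\varepsilon_1,\dots,\varepsilon_n\in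 I$ and every $a\in I$, $$\Big\{\big(D_{\gamma_1,\gamma_2}d(a,x)\big)^m H(x)\Big\}_{\gamma_1,\gamma_2}[\varepsilon_1,\dots,\varepsilon_n]=h\big(\underbrace{(\delta_1,\delta_2),\dots,(\delta_1,\delta_2)}_{m}/(u_1,v_1),\dots,(u_n,v_n)\big),$$ where $(u_i,v_i)=(\gamma_1(\varepsilon_i),\gamma_2(\varepsilon_i))$ and the divided difference is taken in the variable $x$. -/

import Mathlib

open Filter Topology

noncomputable section

namespace GammaBlossom

/-- The function `d(x, y) = γ₁(x) γ₂(y) - γ₁(y) γ₂(x)`. -/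
def dist2 (γ₁ γ₂ : ℝ → ℝ) (x y : ℝ) : ℝ := γ₁ x * γ₂ y - γ₁ y * γ₂ x

/-- The non-polynomial divided difference `f_{γ₁,γ₂}[x₀, …, xₙ]` (at distinct abscissas),
`f[x₀, …, xₙ₊₁] = (f[x₀, …, xₙ₋₁, xₙ₊₁] - f[x₀, …, xₙ]) / d(xₙ, xₙ₊₁)`. -/
def divDiff (γ₁ γ₂ : ℝ → ℝ) (f : ℝ → ℝ) : (n : ℕ) → (Fin (n + 1) → ℝ) → ℝ
  | 0, x => f (x 0)
  | n + 1, x =>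
      (divDiff γ₁ γ₂ f n (fun i => x ((Fin.last n).castSucc.succAbove i))
          - divDiff γ₁ γ₂ f n (fun i => x i.castSucc))
        / dist2 γ₁ γ₂ (x (Fin.last n).castSucc) (x (Fin.last (n + 1)))

/-- The difference quotient of the generalized derivative at `a`. -/
def genQuotient (γ₁ γ₂ : ℝ → ℝ) (f : ℝ → ℝ) (a x : ℝ) : ℝ :=
  (f x - f a) / dist2 γ₁ γ₂ a x

/-- The limit defining the generalized derivative of `f` at `a` (within the domain `I`) exists. -/
def GenDifferentiableAt (I : Set ℝ) (γ₁ γ₂ : ℝ → ℝ) (f : ℝ → ℝ) (a : ℝ) : Prop :=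
  ∃ L : ℝ, Tendsto (genQuotient γ₁ γ₂ f a) (𝓝[I \ {a}] a) (𝓝 L)

/-- The generalized derivative
`D_{γ₁,γ₂} f (a) = lim_{x → a} (f(x) - f(a)) / d(a, x)`, with `x` in the domain `I`. -/
def genDeriv (I : Set ℝ) (γ₁ γ₂ : ℝ → ℝ) (f : ℝ → ℝ) (a : ℝ) : ℝ :=
  limUnder (𝓝[I \ {a}] a) (genQuotient γ₁ γ₂ f a)

/-- The point `(γ₁(t), γ₂(t))` of the plane. -/
def pt (γ₁ γ₂ : ℝ → ℝ) (t : ℝ) : ℝ × ℝ := (γ₁ t, γ₂ t)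

/-- `h m n X U` is the value `h((x₁,w₁),…,(x_m,w_m) / (u₁,v₁),…,(u_n,v_n))`. The family is an
extended non-polynomial homogeneous blossom of order `k` of `H` if it satisfies the four axioms
for all `m`, `n` with `m - n = k`. The pairs `(x_i, w_i)` range over the plane and the pairs
`(u_j, v_j)` over the points of the curve `{(γ₁(t), γ₂(t)) : t ∈ I}`. -/
structure IsExtendedBlossom (I : Set ℝ) (γ₁ γ₂ : ℝ → ℝ) (k : ℤ) (H : ℝ → ℝ)
    (h : (m n : ℕ) → (Fin m → ℝ × ℝ) → (Fin n → ℝ × ℝ) → ℝ) : Prop where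
  bisymmetry : ∀ m n : ℕ, (m : ℤ) - n = k →
    ∀ (X : Fin m → ℝ × ℝ) (U : Fin n → ℝ × ℝ), (∀ j, U j ∈ pt γ₁ γ₂ '' I) →
    ∀ (σ : Equiv.Perm (Fin m)) (τ : Equiv.Perm (Fin n)),
      h m n (fun i => X (σ i)) (fun j => U (τ j)) = h m n X U
  multilinear : ∀ m n : ℕ, (m : ℤ) - n = k →
    ∀ (X : Fin m → ℝ × ℝ) (U : Fin n → ℝ × ℝ), (∀ j, U j ∈ pt γ₁ γ₂ '' I) →
    ∀ (i : Fin m) (α β : ℝ) (p q : ℝ × ℝ),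
      h m n (Function.update X i (α • p + β • q)) U
        = α * h m n (Function.update X i p) U + β * h m n (Function.update X i q) U
  cancellation : ∀ m n : ℕ, (m : ℤ) - n = k →
    ∀ (X : Fin m → ℝ × ℝ) (U : Fin n → ℝ × ℝ), (∀ j, U j ∈ pt γ₁ γ₂ '' I) →
    ∀ p ∈ pt γ₁ γ₂ '' I,
      h (m + 1) (n + 1) (Fin.snoc (α := fun _ => ℝ × ℝ) X p)
        (Fin.snoc (α := fun _ => ℝ × ℝ) U p) = h m n X U
  diagonal : ∀ m n : ℕ, (m : ℤ) - n = k → ∀ t ∈ I,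
    h m n (fun _ => pt γ₁ γ₂ t) (fun _ => pt γ₁ γ₂ t) = H t

end GammaBlossom

end

noncomputable section

namespace GammaBlossom

/-! If `c₁ γ₁ + c₂ γ₂ = 1` on `I`, the curve lies on a line of direction `δ = (-c₂, c₁)`, and `pt y
- pt x = d(x, y) • δ` (`pt_sub_pt_eq`). Hence the difference quotients are constant: the derivatives
of `γ₁`, `γ₂` form `δ`, and that of `d(·, x)` is `det (δ, pt x) = -1`. The identity becomes `h(δ, …,
δ / U) = (-1)^m H[ε₁, …, εₙ]` (`IsExtendedBlossom.eq_divDiff`), where writing `δ` as a multiple of a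
chord turns linearity and cancellation into the divided difference recursion.

For existence, `H` may be arbitrary, so the blossom is built algebraically: sum, over the distinct
nodes `p`, the number `H` at `p` times the residue at `p` of `∏ det (Xᵢ, ·) / ∏ det (Uⱼ, ·)` along
the line (`isExtendedBlossom_residueBlossom`). -/

/-- The determinant of two vectors of the plane. -/
def det2 (p q : ℝ × ℝ) : ℝ := p.1 * q.2 - q.1 * p.2

theorem dist2_eq_det2 (γ₁ γ₂ : ℝ → ℝ) (x y : ℝ) :
    dist2 γ₁ γ₂ x y = det2 (pt γ₁ γ₂ x) (pt γ₁ γ₂ y) := rfl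

theorem det2_self (p : ℝ × ℝ) : det2 p p = 0 := by
  simp only [det2]; ring

theorem det2_comb (α β : ℝ) (p q r : ℝ × ℝ) :
    det2 (α • p + β • q) r = α * det2 p r + β * det2 q r := by
  simp only [det2, Prod.fst_add, Prod.snd_add, Prod.smul_fst, Prod.smul_snd, smul_eq_mul]; ring

/-! ### Residues of the kernel. -/

/-- The power series `det (q, p + z δ)` in the variable `z`. -/
def detSeries (δ p q : ℝ × ℝ) : PowerSeries ℝ :=
  PowerSeries.C (det2 q p) + PowerSeries.C (det2 q δ) * PowerSeries.X

theorem constantCoeff_detSeries (δ p q : ℝ × ℝ) :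
    PowerSeries.constantCoeff (detSeries δ p q) = det2 q p := by
  simp [detSeries]

theorem detSeries_comb (δ p : ℝ × ℝ) (α β : ℝ) (q r : ℝ × ℝ) :
    detSeries δ p (α • q + β • r)
      = PowerSeries.C α * detSeries δ p q + PowerSeries.C β * detSeries δ p r := by
  simp only [detSeries, det2_comb, map_add, map_mul]; ring

/-- The power series `det (q, p + z δ)` as a Laurent series. -/
def detLaurent (δ p q : ℝ × ℝ) : LaurentSeries ℝ :=
  HahnSeries.ofPowerSeries ℤ ℝ (detSeries δ p q)

theorem detLaurent_ne_zero {δ p q : ℝ × ℝ} (h : det2 q δ ≠ 0) : detLaurent δ p q ≠ 0 := by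
  intro h0
  have h1 : detSeries δ p q = 0 :=
    HahnSeries.ofPowerSeries_injective (Γ := ℤ) (by rw [map_zero]; exact h0)
  have h2 := congrArg (PowerSeries.coeff 1) h1
  simp [detSeries, PowerSeries.coeff_C] at h2
  exact h h2

/-- The Laurent expansion at `p`, in the direction `δ`, of the kernel
`∏ det (Xᵢ, ·) / ∏ det (Uⱼ, ·)`. -/
def kernelSeries {m n : ℕ} (δ p : ℝ × ℝ) (X : Fin m → ℝ × ℝ) (U : Fin n → ℝ × ℝ) :
    LaurentSeries ℝ :=
  (∏ i, detLaurent δ p (X i)) * (∏ j, detLaurent δ p (U j))⁻¹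

/-- The residue at `p` of the kernel `∏ det (Xᵢ, ·) / ∏ det (Uⱼ, ·)`. -/
def kernelResidue {m n : ℕ} (δ p : ℝ × ℝ) (X : Fin m → ℝ × ℝ) (U : Fin n → ℝ × ℝ) : ℝ :=
  (kernelSeries δ p X U).coeff (-1)

theorem kernelResidue_perm {m n : ℕ} (δ p : ℝ × ℝ) (X : Fin m → ℝ × ℝ) (U : Fin n → ℝ × ℝ)
    (σ : Equiv.Perm (Fin m)) (τ : Equiv.Perm (Fin n)) :
    kernelResidue δ p (fun i => X (σ i)) (fun j => U (τ j)) = kernelResidue δ p X U := by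
  simp only [kernelResidue, kernelSeries]
  rw [Equiv.prod_comp σ (fun i => detLaurent δ p (X i)),
    Equiv.prod_comp τ (fun j => detLaurent δ p (U j))]

theorem kernelResidue_update {m n : ℕ} (δ p : ℝ × ℝ) (X : Fin m → ℝ × ℝ) (U : Fin n → ℝ × ℝ)
    (i : Fin m) (α β : ℝ) (q r : ℝ × ℝ) :
    kernelResidue δ p (Function.update X i (α • q + β • r)) U
      = α * kernelResidue δ p (Function.update X i q) U
        + β * kernelResidue δ p (Function.update X i r) U := by
  have key : ∀ s, kernelSeries δ p (Function.update X i s) U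
      = detLaurent δ p s * ((∏ k ∈ Finset.univ \ {i}, detLaurent δ p (X k))
        * (∏ j, detLaurent δ p (U j))⁻¹) := by
    intro s
    have h1 : (∏ k, detLaurent δ p (Function.update X i s k))
        = ∏ k, Function.update (fun k => detLaurent δ p (X k)) i (detLaurent δ p s) k := by
      refine Finset.prod_congr rfl fun k _ => ?_
      by_cases hk : k = i
      · subst hk; simp
      · simp [hk]
    rw [kernelSeries, h1, Finset.prod_update_of_mem (Finset.mem_univ i), mul_assoc]
  have lin : detLaurent δ p (α • q + β • r)
      = HahnSeries.C α * detLaurent δ p q + HahnSeries.C β * detLaurent δ p r := by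
    simp only [detLaurent, detSeries_comb, map_add, map_mul, HahnSeries.ofPowerSeries_C]
  simp only [kernelResidue]
  rw [key, key, key, lin, add_mul, mul_assoc, mul_assoc, HahnSeries.coeff_add,
    HahnSeries.C_mul_eq_smul, HahnSeries.C_mul_eq_smul, HahnSeries.coeff_smul,
    HahnSeries.coeff_smul, smul_eq_mul, smul_eq_mul]

theorem kernelResidue_snoc {m n : ℕ} (δ p : ℝ × ℝ) (X : Fin m → ℝ × ℝ) (U : Fin n → ℝ × ℝ)
    {q : ℝ × ℝ} (hq : det2 q δ ≠ 0) :
    kernelResidue δ p (Fin.snoc (α := fun _ => ℝ × ℝ) X q)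
      (Fin.snoc (α := fun _ => ℝ × ℝ) U q) = kernelResidue δ p X U := by
  have h0 := detLaurent_ne_zero (p := p) hq
  simp only [kernelResidue, kernelSeries, Fin.prod_univ_castSucc, Fin.snoc_castSucc,
    Fin.snoc_last]
  rw [mul_inv, mul_mul_mul_comm, mul_comm (detLaurent δ p q), mul_comm, mul_assoc,
    mul_comm (detLaurent δ p q)]
  congr 1
  field_simp

/-- The denominator has nonzero constant term, so it is a unit among power series and the kernel has
no pole at `p`. -/
theorem kernelResidue_eq_zero {m n : ℕ} (δ p : ℝ × ℝ) (X : Fin m → ℝ × ℝ)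
    (U : Fin n → ℝ × ℝ) (hU : ∀ j, det2 (U j) p ≠ 0) : kernelResidue δ p X U = 0 := by
  have hc : PowerSeries.constantCoeff (∏ j, detSeries δ p (U j)) ≠ 0 := by
    rw [map_prod]
    exact Finset.prod_ne_zero_iff.2 fun j _ => by
      rw [constantCoeff_detSeries]; exact hU j
  have hmul := congrArg (HahnSeries.ofPowerSeries ℤ ℝ) (PowerSeries.mul_inv_cancel _ hc)
  rw [map_mul, map_one] at hmul
  have h1 : kernelSeries δ p X U = HahnSeries.ofPowerSeries ℤ ℝ
      ((∏ i, detSeries δ p (X i)) * (∏ j, detSeries δ p (U j))⁻¹) := by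
    rw [map_mul, eq_inv_of_mul_eq_one_right hmul]
    simp only [kernelSeries, detLaurent, map_prod]
  rw [kernelResidue, h1, HahnSeries.ofPowerSeries_apply]
  apply HahnSeries.embDomain_of_notMem_range
  rintro ⟨k, hk⟩
  simp at hk

/-- Every factor equals `z`, so the kernel is `z⁻¹`. -/
theorem kernelResidue_diagonal {δ p : ℝ × ℝ} (hp : det2 p δ = 1) (m : ℕ) :
    kernelResidue δ p (fun _ : Fin m => p) (fun _ : Fin (m + 1) => p) = 1 := by
  have h1 : detLaurent δ p p = HahnSeries.single (1 : ℤ) (1 : ℝ) := by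
    simp [detLaurent, detSeries, det2_self, hp, HahnSeries.ofPowerSeries_X]
  have h0 : detLaurent δ p p ≠ 0 := detLaurent_ne_zero (by rw [hp]; exact one_ne_zero)
  have h2 : kernelSeries δ p (fun _ : Fin m => p) (fun _ : Fin (m + 1) => p)
      = (detLaurent δ p p)⁻¹ := by
    simp only [kernelSeries, Finset.prod_const, Finset.card_univ, Fintype.card_fin]
    rw [pow_succ, mul_inv, ← mul_assoc, mul_inv_cancel₀ (pow_ne_zero _ h0), one_mul]
  rw [kernelResidue, h2, h1, HahnSeries.inv_single]
  simp

/-! ### Existence of a blossom of order `-1`. -/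

/-- The sum over the nodes of the residues of `G(p) ∏ det (Xᵢ, p) / ∏ det (Uⱼ, p)`, where `G` is
treated as constant near each node. -/
def residueBlossom (δ : ℝ × ℝ) (G : ℝ × ℝ → ℝ) (m n : ℕ) (X : Fin m → ℝ × ℝ)
    (U : Fin n → ℝ × ℝ) : ℝ :=
  ∑ p ∈ Finset.univ.image U, G p * kernelResidue δ p X U

theorem isExtendedBlossom_residueBlossom {I : Set ℝ} {γ₁ γ₂ : ℝ → ℝ} {δ : ℝ × ℝ}
    (hd : ∀ x ∈ I, ∀ y ∈ I, x ≠ y → dist2 γ₁ γ₂ x y ≠ 0)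
    (hδ : ∀ x ∈ I, det2 (pt γ₁ γ₂ x) δ = 1) {G : ℝ × ℝ → ℝ} {H : ℝ → ℝ}
    (hG : ∀ x ∈ I, G (pt γ₁ γ₂ x) = H x) :
    IsExtendedBlossom I γ₁ γ₂ (-1) H (residueBlossom δ G) where
  bisymmetry m n _ X U _ σ τ := by
    have himg : Finset.univ.image (fun j => U (τ j)) = Finset.univ.image U := by
      ext p
      simp only [Finset.mem_image, Finset.mem_univ, true_and]
      exact (τ.surjective.exists (p := fun j => U j = p)).symm
    simp only [residueBlossom, himg, kernelResidue_perm]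
  multilinear m n _ X U _ i α β p q := by
    simp only [residueBlossom, kernelResidue_update, Finset.mul_sum, ← Finset.sum_add_distrib]
    exact Finset.sum_congr rfl fun _ _ => by ring
  cancellation m n _ X U hU p hp := by
    obtain ⟨y, hy, rfl⟩ := hp
    have hq : det2 (pt γ₁ γ₂ y) δ ≠ 0 := by rw [hδ y hy]; exact one_ne_zero
    simp only [residueBlossom, kernelResidue_snoc _ _ _ _ hq]
    symm
    -- Appending a node enlarges the index set at most by that node; if it is new, the cancelled
    -- kernel has no pole there.
    refine Finset.sum_subset (fun p hp => ?_) fun p hp hp' => ?_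
    · simp only [Finset.mem_image, Finset.mem_univ, true_and] at hp ⊢
      obtain ⟨j, rfl⟩ := hp
      exact ⟨j.castSucc, by simp⟩
    · simp only [Finset.mem_image, Finset.mem_univ, true_and] at hp hp'
      obtain ⟨j, hj⟩ := hp
      have hpy : p = pt γ₁ γ₂ y := by
        induction j using Fin.lastCases with
        | last => simpa using hj.symm
        | cast j => exact absurd ⟨j, by simpa using hj⟩ hp'
      rw [kernelResidue_eq_zero, mul_zero]
      intro k
      obtain ⟨x, hx, hxk⟩ := hU k
      rw [← hxk, hpy, ← dist2_eq_det2]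
      refine hd x hx y hy ?_
      rintro rfl
      exact hp' ⟨k, by rw [← hxk, hpy]⟩
  diagonal m n hmn t ht := by
    obtain rfl : n = m + 1 := by omega
    have himg : Finset.univ.image (fun _ : Fin (m + 1) => pt γ₁ γ₂ t) = {pt γ₁ γ₂ t} :=
      Finset.image_const Finset.univ_nonempty _
    rw [residueBlossom, himg, Finset.sum_singleton, kernelResidue_diagonal (hδ t ht), mul_one,
      hG t ht]

theorem exists_isExtendedBlossom {I : Set ℝ} {γ₁ γ₂ : ℝ → ℝ} {δ : ℝ × ℝ}
    (hd : ∀ x ∈ I, ∀ y ∈ I, x ≠ y → dist2 γ₁ γ₂ x y ≠ 0)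
    (hδ : ∀ x ∈ I, det2 (pt γ₁ γ₂ x) δ = 1) (H : ℝ → ℝ) :
    ∃ h, IsExtendedBlossom I γ₁ γ₂ (-1) H h := by
  have hinj : Set.InjOn (pt γ₁ γ₂) I := by
    intro x hx y hy hxy
    by_contra hne
    exact hd x hx y hy hne (by rw [dist2_eq_det2, hxy, det2_self])
  exact ⟨_, isExtendedBlossom_residueBlossom (G := fun p => H (Function.invFunOn (pt γ₁ γ₂) I p))
    hd hδ fun x hx => by rw [hinj.leftInvOn_invFunOn hx]⟩

/-! ### Blossom values as divided differences. -/

theorem divDiff_const_mul (γ₁ γ₂ : ℝ → ℝ) (c : ℝ) (f : ℝ → ℝ) (n : ℕ) (x : Fin (n + 1) → ℝ) :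
    divDiff γ₁ γ₂ (fun t => c * f t) n x = c * divDiff γ₁ γ₂ f n x := by
  induction n with
  | zero => rfl
  | succ n ih => simp only [divDiff, ih]; ring

theorem divDiff_congr {I : Set ℝ} (γ₁ γ₂ : ℝ → ℝ) {f g : ℝ → ℝ} (hfg : Set.EqOn f g I) (n : ℕ)
    (x : Fin (n + 1) → ℝ) (hx : ∀ i, x i ∈ I) : divDiff γ₁ γ₂ f n x = divDiff γ₁ γ₂ g n x := by
  induction n with
  | zero => exact hfg (hx 0)
  | succ n ih =>
    simp only [divDiff]
    rw [ih _ fun i => hx _, ih _ fun i => hx _]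

/-- Cancellation only removes the last node; this swap brings the penultimate one there. -/
theorem snoc_succAbove_eq_swap {α : Type*} {m : ℕ} (U : Fin (m + 2) → α) :
    (Fin.snoc (α := fun _ => α) (fun i => U ((Fin.last m).castSucc.succAbove i))
        (U (Fin.last m).castSucc))
      = fun j => U (Equiv.swap (Fin.last m).castSucc (Fin.last (m + 1)) j) := by
  funext j
  induction j using Fin.lastCases with
  | last => simp
  | cast j =>
    rw [Fin.snoc_castSucc]
    induction j using Fin.lastCases with
    | last => simp
    | cast j =>
      have h1 : (Fin.last m).castSucc.succAbove j.castSucc = j.castSucc.castSucc :=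
        Fin.succAbove_of_castSucc_lt _ _ (by simp [Fin.lt_def])
      rw [h1, Equiv.swap_apply_of_ne_of_ne]
      · simp [Fin.ext_iff, j.isLt.ne]
      · exact (Fin.castSucc_lt_last _).ne

theorem IsExtendedBlossom.eq_divDiff {I : Set ℝ} {γ₁ γ₂ : ℝ → ℝ} {δ : ℝ × ℝ} {H : ℝ → ℝ}
    {h : (m n : ℕ) → (Fin m → ℝ × ℝ) → (Fin n → ℝ × ℝ) → ℝ}
    (hh : IsExtendedBlossom I γ₁ γ₂ (-1) H h)
    (hd : ∀ x ∈ I, ∀ y ∈ I, x ≠ y → dist2 γ₁ γ₂ x y ≠ 0)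
    (hδ : ∀ x ∈ I, ∀ y ∈ I, pt γ₁ γ₂ y - pt γ₁ γ₂ x = dist2 γ₁ γ₂ x y • δ)
    (m : ℕ) (ε : Fin (m + 1) → ℝ) (hinj : Function.Injective ε) (hε : ∀ i, ε i ∈ I) :
    h m (m + 1) (fun _ => δ) (fun i => pt γ₁ γ₂ (ε i))
      = (-1) ^ m * divDiff γ₁ γ₂ H m ε := by
  induction m with
  | zero =>
    have h0 := hh.diagonal 0 1 (by norm_num) (ε 0) (hε 0)
    have hU : (fun i => pt γ₁ γ₂ (ε i)) = fun _ => pt γ₁ γ₂ (ε 0) := by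
      funext i; rw [Fin.fin_one_eq_zero i]
    have hX : (fun _ : Fin 0 => δ) = fun _ => pt γ₁ γ₂ (ε 0) := Subsingleton.elim _ _
    rw [hU, hX, h0]
    simp [divDiff]
  | succ m ih =>
    set a := ε (Fin.last m).castSucc with ha
    set b := ε (Fin.last (m + 1)) with hb
    have hab : a ≠ b := fun e => (Fin.castSucc_lt_last _).ne (hinj e)
    have hD : dist2 γ₁ γ₂ a b ≠ 0 := hd a (hε _) b (hε _) hab
    set D := dist2 γ₁ γ₂ a b with hDdef
    set U : Fin (m + 2) → ℝ × ℝ := fun i => pt γ₁ γ₂ (ε i) with hU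
    have hUI : ∀ j, U j ∈ pt γ₁ γ₂ '' I := fun j => ⟨_, hε j, rfl⟩
    -- Cancelling `b` leaves the term that the recursion subtracts, and cancelling `a` the one it
    -- adds: each step contributes a factor `-1`.
    have hcomb : δ = D⁻¹ • pt γ₁ γ₂ b + (-D⁻¹) • pt γ₁ γ₂ a := by
      rw [neg_smul, ← sub_eq_add_neg, ← smul_sub, hδ a (hε _) b (hε _), smul_smul,
        inv_mul_cancel₀ hD, one_smul]
    have hlast : ∀ p : ℝ × ℝ, Function.update (fun _ : Fin (m + 1) => δ) (Fin.last m) p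
        = Fin.snoc (α := fun _ => ℝ × ℝ) (fun _ : Fin m => δ) p := by
      intro p
      funext j
      induction j using Fin.lastCases with
      | last => simp
      | cast j => simp [(Fin.castSucc_lt_last j).ne]
    have hlin := hh.multilinear (m + 1) (m + 2) (by push_cast; ring) (fun _ => δ) U hUI
      (Fin.last m) D⁻¹ (-D⁻¹) (pt γ₁ γ₂ b) (pt γ₁ γ₂ a)
    rw [← hcomb, hlast, hlast, hlast] at hlin
    have hconst : Fin.snoc (α := fun _ => ℝ × ℝ) (fun _ : Fin m => δ) δ
        = fun _ : Fin (m + 1) => δ := by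
      rw [← hlast]; exact Function.update_eq_self _ _
    rw [hconst] at hlin
    have hb' : h (m + 1) (m + 2) (Fin.snoc (α := fun _ => ℝ × ℝ) (fun _ : Fin m => δ)
        (pt γ₁ γ₂ b)) U = (-1) ^ m * divDiff γ₁ γ₂ H m (fun i => ε i.castSucc) := by
      rw [← ih (fun i => ε i.castSucc) (hinj.comp (Fin.castSucc_injective _)) fun i => hε _,
        ← hh.cancellation m (m + 1) (by push_cast; ring) _ _ (fun j => ⟨_, hε _, rfl⟩)
          (pt γ₁ γ₂ b) ⟨b, hε _, rfl⟩]
      congr 1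
      exact (Fin.snoc_init_self U).symm
    have ha' : h (m + 1) (m + 2) (Fin.snoc (α := fun _ => ℝ × ℝ) (fun _ : Fin m => δ)
        (pt γ₁ γ₂ a)) U = (-1) ^ m * divDiff γ₁ γ₂ H m
          (fun i => ε ((Fin.last m).castSucc.succAbove i)) := by
      rw [← ih (fun i => ε ((Fin.last m).castSucc.succAbove i))
          (hinj.comp Fin.succAbove_right_injective) fun i => hε _,
        ← hh.cancellation m (m + 1) (by push_cast; ring) _ _ (fun j => ⟨_, hε _, rfl⟩)
          (pt γ₁ γ₂ a) ⟨a, hε _, rfl⟩,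
        ← hh.bisymmetry (m + 1) (m + 2) (by push_cast; ring) _ U hUI 1
          (Equiv.swap (Fin.last m).castSucc (Fin.last (m + 1))),
        ← snoc_succAbove_eq_swap U]
      rfl
    rw [hlin, hb', ha', divDiff, ← ha, ← hb, ← hDdef]
    ring

/-! ### Generalized derivatives. -/

theorem tendsto_genQuotient {I : Set ℝ} {γ₁ γ₂ : ℝ → ℝ}
    (hd : ∀ x ∈ I, ∀ y ∈ I, x ≠ y → dist2 γ₁ γ₂ x y ≠ 0) {f : ℝ → ℝ} {a L : ℝ} (ha : a ∈ I)
    (hf : ∀ x ∈ I, f x - f a = dist2 γ₁ γ₂ a x * L) :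
    Tendsto (genQuotient γ₁ γ₂ f a) (𝓝[I \ {a}] a) (𝓝 L) := by
  refine tendsto_const_nhds.congr' ?_
  filter_upwards [self_mem_nhdsWithin] with x hx
  rw [genQuotient, hf x hx.1, mul_div_cancel_left₀ _ (hd a ha x hx.1 (Ne.symm hx.2))]

/-- Makes limits unique, so that `genDeriv` takes the computed values. -/
theorem nhdsWithin_diff_singleton_neBot {I : Set ℝ} (hI : I.OrdConnected) (hI' : I.Nontrivial)
    {a : ℝ} (ha : a ∈ I) : (𝓝[I \ {a}] a).NeBot :=
  accPt_principal_iff_nhdsWithin.1 (hI.isPreconnected.preperfect_of_nontrivial hI' a ha)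

/-- If `c₁ γ₁ + c₂ γ₂ = 1` on `I`, then the curve runs along the line of direction `(-c₂, c₁)`. -/
theorem pt_sub_pt_eq {I : Set ℝ} {γ₁ γ₂ : ℝ → ℝ} {c₁ c₂ : ℝ}
    (hc : ∀ x ∈ I, c₁ * γ₁ x + c₂ * γ₂ x = 1) {x y : ℝ} (hx : x ∈ I) (hy : y ∈ I) :
    pt γ₁ γ₂ y - pt γ₁ γ₂ x = dist2 γ₁ γ₂ x y • ((-c₂, c₁) : ℝ × ℝ) := by
  have h1 := hc x hx
  have h2 := hc y hy
  ext
  · simp only [pt, dist2, Prod.fst_sub, Prod.smul_fst, smul_eq_mul]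
    linear_combination γ₁ x * h2 - γ₁ y * h1
  · simp only [pt, dist2, Prod.snd_sub, Prod.smul_snd, smul_eq_mul]
    linear_combination γ₂ x * h2 - γ₂ y * h1

end GammaBlossom

end

theorem mainTheorem7 (I : Set ℝ) (hI : I.OrdConnected) (hI' : I.Nontrivial)
    (γ₁ γ₂ : ℝ → ℝ)
    (hd : ∀ x ∈ I, ∀ y ∈ I, x ≠ y → GammaBlossom.dist2 γ₁ γ₂ x y ≠ 0)
    (hone : (1 : I → ℝ) ∈ Submodule.span ℝ {I.domRestrict γ₁, I.domRestrict γ₂})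
    (H : ℝ → ℝ) :
    (∃ h, GammaBlossom.IsExtendedBlossom I γ₁ γ₂ (-1) H h) ∧
    (∀ a ∈ I,
      GammaBlossom.GenDifferentiableAt I γ₁ γ₂ γ₁ a ∧
      GammaBlossom.GenDifferentiableAt I γ₁ γ₂ γ₂ a ∧
      ∀ x ∈ I, GammaBlossom.GenDifferentiableAt I γ₁ γ₂
        (fun t => GammaBlossom.dist2 γ₁ γ₂ t x) a) ∧
    ∀ h, GammaBlossom.IsExtendedBlossom I γ₁ γ₂ (-1) H h →
      ∀ (m : ℕ) (ε : Fin (m + 1) → ℝ), Function.Injective ε → (∀ i, ε i ∈ I) →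
      ∀ a ∈ I,
        GammaBlossom.divDiff γ₁ γ₂
            (fun x => (GammaBlossom.genDeriv I γ₁ γ₂
                (fun t => GammaBlossom.dist2 γ₁ γ₂ t x) a) ^ m * H x) m ε
          = h m (m + 1)
              (fun _ => (GammaBlossom.genDeriv I γ₁ γ₂ γ₁ a, GammaBlossom.genDeriv I γ₁ γ₂ γ₂ a))
              (fun i => (γ₁ (ε i), γ₂ (ε i))) := by
  obtain ⟨c₁, c₂, hc'⟩ := Submodule.mem_span_pair.1 hone
  have hc : ∀ x ∈ I, c₁ * γ₁ x + c₂ * γ₂ x = 1 := fun x hx => congrFun hc' ⟨x, hx⟩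
  have hsub : ∀ x ∈ I, ∀ y ∈ I, GammaBlossom.pt γ₁ γ₂ y - GammaBlossom.pt γ₁ γ₂ x
      = GammaBlossom.dist2 γ₁ γ₂ x y • ((-c₂, c₁) : ℝ × ℝ) :=
    fun x hx y hy => GammaBlossom.pt_sub_pt_eq hc hx hy
  have hdet : ∀ x ∈ I, GammaBlossom.det2 (GammaBlossom.pt γ₁ γ₂ x) (-c₂, c₁) = 1 := by
    intro x hx
    simp only [GammaBlossom.det2, GammaBlossom.pt]
    linear_combination hc x hx
  have h₁ : ∀ a ∈ I, Tendsto (GammaBlossom.genQuotient γ₁ γ₂ γ₁ a) (𝓝[I \ {a}] a) (𝓝 (-c₂)) :=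
    fun a ha => GammaBlossom.tendsto_genQuotient hd ha
      fun x hx => congrArg Prod.fst (hsub a ha x hx)
  have h₂ : ∀ a ∈ I, Tendsto (GammaBlossom.genQuotient γ₁ γ₂ γ₂ a) (𝓝[I \ {a}] a) (𝓝 c₁) :=
    fun a ha => GammaBlossom.tendsto_genQuotient hd ha
      fun x hx => congrArg Prod.snd (hsub a ha x hx)
  have h₃ : ∀ a ∈ I, ∀ x ∈ I, Tendsto (GammaBlossom.genQuotient γ₁ γ₂
      (fun t => GammaBlossom.dist2 γ₁ γ₂ t x) a) (𝓝[I \ {a}] a) (𝓝 (-1)) := by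
    refine fun a ha x hx => GammaBlossom.tendsto_genQuotient hd ha fun t ht => ?_
    have e₁ := congrArg Prod.fst (hsub a ha t ht)
    have e₂ := congrArg Prod.snd (hsub a ha t ht)
    simp only [GammaBlossom.pt, Prod.fst_sub, Prod.snd_sub, Prod.smul_fst, Prod.smul_snd,
      smul_eq_mul] at e₁ e₂
    have e₃ := hc x hx
    set D := GammaBlossom.dist2 γ₁ γ₂ a t
    simp only [GammaBlossom.dist2]
    -- By bilinearity `d(t, x) - d(a, x) = D · det (δ, pt x)`, and `e₃` says that this determinant
    -- is `-1`.
    linear_combination γ₂ x * e₁ - γ₁ x * e₂ - D * e₃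
  refine ⟨GammaBlossom.exists_isExtendedBlossom hd hdet H,
    fun a ha => ⟨⟨_, h₁ a ha⟩, ⟨_, h₂ a ha⟩, fun x hx => ⟨_, h₃ a ha x hx⟩⟩, ?_⟩
  intro h hh m ε hinj hε a ha
  have := GammaBlossom.nhdsWithin_diff_singleton_neBot hI hI' ha
  have d₁ : GammaBlossom.genDeriv I γ₁ γ₂ γ₁ a = -c₂ := (h₁ a ha).limUnder_eq
  have d₂ : GammaBlossom.genDeriv I γ₁ γ₂ γ₂ a = c₁ := (h₂ a ha).limUnder_eq
  have d₃ : ∀ x ∈ I, GammaBlossom.genDeriv I γ₁ γ₂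
      (fun t => GammaBlossom.dist2 γ₁ γ₂ t x) a = -1 := fun x hx => (h₃ a ha x hx).limUnder_eq
  rw [d₁, d₂]
  refine Eq.trans ?_ (hh.eq_divDiff hd hsub m ε hinj hε).symm
  -- The value `-1` of the derivative is known only for `x ∈ I`, so the two functions are compared
  -- on `I`, which contains the nodes.
  rw [← GammaBlossom.divDiff_const_mul]
  refine GammaBlossom.divDiff_congr γ₁ γ₂ (I := I) (fun x hx => ?_) m ε hε
  simp only [d₃ x hx]
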